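/- Let $d\ge 0$ and let $\mathcal P$ be the convex set of Borel probability measures on $\mathbb R^d$, regarded as a subset of the real vector space of finite signed Borel measures. A measure $\lambda\in\mathcal P$ has a mean if all coordinate functions are $\lambda$-integrable, and its mean is then $m(\lambda)=\int_{\mathbb R^d}x\,d\lambda(x)$. The convex core $\mathrm{cc}(\mu)$ of $\mu\in\mathcal P$ is the intersection of all convex Borel sets $C\subseteq\mathbb R^d$ with $\mu(C)=\mu(\mathbb R^d)$. For a convex subset $K$ of a real vector space, an extreme set of $K$ is a subset $E\subseteq K$ that contains the closed segment $[x,y]$ for all $x\ne y$ in $K$ whose open segment $(x,y)$ meets $E$. A face of $K$ is a convex extreme set of $K$, and $F_K(x)$ denotes the intersection of all faces of $K$ that contain $x\in K$. The relative algebraic interior $\mathrm{rai}(K)$ is the set of all $x\in K$ such that for every line $g$ in the affine hull of $K$ with $x\in g$, the set $g\cap K$ includes a (nondegenerate) open segment containing $x$. Let $\mu\in\mathcal P$ have a mean. Then every $\lambda\in F_{\mathcal P}(\mu)$ has a mean, $$\mathrm{cc}(\mu)=m\big(F_{\mathcal P}(\mu)\big),\qquad \mathrm{rai}(\mathrm{cc}(\mu))=m\big(\mathrm{rai}(F_{\mathcal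 P}(\mu))\big),$$ and $$\mathrm{rai}(\mathrm{cc}(\mu))=m\Big(\Big\{\lambda\in\mathcal P \;:\; \lambda\ll\mu,\ \mu\ll\lambda,\ \exists\, c\in(1,\infty):\ \tfrac1c\le \tfrac{d\lambda}{d\mu}\le c\ \ \mu\text{-a.s.}\Big\}\Big).$$ -/

import Mathlib

open MeasureTheory

noncomputable section

namespace ConvexCore

section Faces

variable {V : Type*} [AddCommGroup V] [Module ℝ V]

/-- A face of a convex set `K` is a convex extreme subset of `K`. -/
def IsFaceOf (K F : Set V) : Prop := IsExtreme ℝ K F ∧ Convex ℝ F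

/-- The face of `K` generated by `x`: the intersection of all faces of `K` containing `x`. -/
def generatedFace (K : Set V) (x : V) : Set V := ⋂₀ {F | IsFaceOf K F ∧ x ∈ F}

/-- The relative algebraic interior of `K`: the points `x` of `K` such that for every line `g` in
the affine hull of `K` containing `x`, the set `g ∩ K` includes a (nondegenerate) open segment
containing `x`. The lines through `x` in the affine hull are those joining `x` to another of its
points `y`. -/
def rai (K : Set V) : Set V :=
  {x | x ∈ K ∧ ∀ y ∈ affineSpan ℝ K, y ≠ x →
    ∃ a b : V, a ≠ b ∧ x ∈ openSegment ℝ a b ∧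
      openSegment ℝ a b ⊆ (affineSpan ℝ {x, y} : Set V) ∩ K}

end Faces

section ProbabilityMeasures

variable {Ω : Type*} [MeasurableSpace Ω]

/-- A probability measure as an element of the real vector space of finite signed measures. -/
def toSigned (μ : ProbabilityMeasure Ω) : SignedMeasure Ω := (μ : Measure Ω).toSignedMeasure

/-- The convex set of all probability measures on `Ω`, in the space of finite signed measures. -/
def probSet (Ω : Type*) [MeasurableSpace Ω] : Set (SignedMeasure Ω) :=
  Set.range (toSigned : ProbabilityMeasure Ω → SignedMeasure Ω)

/-- The face of the convex set of probability measures generated by `μ`. -/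
def probFace (μ : ProbabilityMeasure Ω) : Set (SignedMeasure Ω) :=
  generatedFace (probSet Ω) (toSigned μ)

end ProbabilityMeasures

section Euclidean

variable {d : ℕ}

/-- A Borel probability measure on `ℝ^d` has a mean if each coordinate function is integrable. -/
def HasMean (μ : ProbabilityMeasure (EuclideanSpace ℝ (Fin d))) : Prop :=
  ∀ i, Integrable (fun x : EuclideanSpace ℝ (Fin d) => x i) (μ : Measure _)

/-- The mean `∫ x dμ(x)`, meaningful if `HasMean μ`. -/
def mean (μ : ProbabilityMeasure (EuclideanSpace ℝ (Fin d))) : EuclideanSpace ℝ (Fin d) :=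
  ∫ x, x ∂(μ : Measure (EuclideanSpace ℝ (Fin d)))

/-- The convex core: the intersection of all convex Borel sets of full measure. -/
def convexCore (μ : ProbabilityMeasure (EuclideanSpace ℝ (Fin d))) :
    Set (EuclideanSpace ℝ (Fin d)) :=
  ⋂₀ {C | Convex ℝ C ∧ MeasurableSet C ∧
    (μ : Measure (EuclideanSpace ℝ (Fin d))) C =
      (μ : Measure (EuclideanSpace ℝ (Fin d))) Set.univ}

/-- The set of means of the probability measures that belong to a set `S` of signed measures. -/
def meanImage (S : Set (SignedMeasure (EuclideanSpace ℝ (Fin d)))) :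
    Set (EuclideanSpace ℝ (Fin d)) :=
  mean '' {ν | toSigned ν ∈ S}

end Euclidean

end ConvexCore

end

/-!
Write `K` for the convex set of bounded probability densities with respect to `μ`, inside the vector
space of bounded measurable functions. The measures in the face generated by `μ` are exactly those
with a density in `K` (`probFace_eq`): such a measure is a proper convex component of `μ`, and,
conversely, domination by a multiple of `μ` is inherited by convex components. Hence the face is the
image of `K` under the linear map `densityMap`, and the set of its means is the image of `K` under
the linear map `h ↦ ∫ h(x) x dμ(x)`; in particular all these means exist.

The relative algebraic interior of a convex set commutes with linear maps as soon as it is not empty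
(`rai_image`), and `rai K` consists of the densities in `K` that are bounded away from zero
(`mem_rai_probDensities_iff`); it contains the constant `1`. So all three claims reduce to the
equality of the convex core with the set of barycenters of densities in `K` (`convexCore_eq`).

Both inclusions are inductions on the dimension of a subspace that carries the measure, driven by
weak separation of a point from a convex set that need not be closed. A probability measure carried
by a convex set has its barycenter there (`integral_mem_of_convex`), since otherwise the measure is
carried by a separating hyperplane through the barycenter. If `x` is not the barycenter of a density
in `K`, then `μ` is carried by a closed half-space with `x` on its boundary, and the open half-space
together with a convex part of the boundary hyperplane, given by induction for the restriction of
`μ`, is a convex Borel set of full measure that misses `x` (`exists_convex_measurable_notMem`).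
-/

open MeasureTheory

noncomputable section

namespace ConvexCore

/-! ### Relative algebraic interiors -/

section Rai

variable {V V' : Type*} [AddCommGroup V] [Module ℝ V] [AddCommGroup V'] [Module ℝ V']

/-- The directions in which one can move from `x` both forwards and backwards inside the convex
set `K`; they form a linear subspace. -/
def twoSidedDirections {K : Set V} (hK : Convex ℝ K) {x : V} (hx : x ∈ K) : Submodule ℝ V where
  carrier := {v | ∃ ε : ℝ, 0 < ε ∧ x + ε • v ∈ K ∧ x - ε • v ∈ K}
  zero_mem' := ⟨1, one_pos, by simpa using hx, by simpa using hx⟩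
  add_mem' := by
    rintro v w ⟨ε, hε, h1, h2⟩ ⟨δ, hδ, h3, h4⟩
    -- `ε δ / (ε + δ)` is the step that makes both ends convex combinations of the given points.
    have hs : (0 : ℝ) < ε + δ := by positivity
    have key : ∀ p q : V, p ∈ K → q ∈ K → (δ / (ε + δ)) • p + (ε / (ε + δ)) • q ∈ K :=
      fun p q hp hq => hK hp hq (by positivity) (by positivity) (by field_simp; ring)
    refine ⟨ε * δ / (ε + δ), by positivity, ?_, ?_⟩
    · convert key _ _ h1 h3 using 1
      match_scalars <;> field_simp
      ring
    · convert key _ _ h2 h4 using 1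
      match_scalars <;> field_simp
      ring
  smul_mem' := by
    rintro c v ⟨ε, hε, h1, h2⟩
    rcases lt_trichotomy c 0 with hc | rfl | hc
    · have hc0 : c ≠ 0 := hc.ne
      refine ⟨ε / (-c), div_pos hε (neg_pos.2 hc), ?_, ?_⟩
      · convert h2 using 1
        match_scalars
        · rfl
        · field_simp
      · convert h1 using 1
        match_scalars
        · rfl
        · field_simp
    · exact ⟨1, one_pos, by simpa using hx, by simpa using hx⟩
    · refine ⟨ε / c, div_pos hε hc, ?_, ?_⟩
      · convert h1 using 1
        match_scalars
        · rfl
        · field_simp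
      · convert h2 using 1
        match_scalars
        · rfl
        · field_simp

/-- In a convex set `K`, the point `x` is in the relative algebraic interior if and only if every
segment from a point of `K` to `x` can be prolonged in `K` beyond `x`. -/
theorem mem_rai_iff {K : Set V} (hK : Convex ℝ K) {x : V} :
    x ∈ rai K ↔ x ∈ K ∧ ∀ y ∈ K, ∃ ε : ℝ, 0 < ε ∧ x + ε • (x - y) ∈ K := by
  refine and_congr_right fun hx => ⟨fun h y hy => ?_, fun h y hy hyx => ?_⟩
  · rcases eq_or_ne y x with rfl | hyx
    · exact ⟨1, one_pos, by simpa using hx⟩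
    obtain ⟨a, b, hab, ⟨α, β, hα, hβ, hαβ, hxab⟩, hsub⟩ :=
      h y (subset_affineSpan ℝ K hy) hyx
    -- The ends `a`, `b` need not lie in `K`, but the midpoints with `x` do.
    have hmid : ∀ t : ℝ, 0 < t → t < 1 → ∃ r : ℝ, a + t • (b - a) = x + r • (y - x) ∧
        a + t • (b - a) ∈ K := by
      intro t ht ht1
      have hm := hsub (show a + t • (b - a) ∈ openSegment ℝ a b from
        ⟨1 - t, t, by linarith, ht, by ring, by module⟩)
      obtain ⟨r, hr⟩ := mem_affineSpan_pair_iff_exists_lineMap_eq.1 hm.1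
      exact ⟨r, by rw [← hr, AffineMap.lineMap_apply_module']; abel, hm.2⟩
    obtain ⟨s, hs, hsK⟩ := hmid (β / 2) (by linarith) (by linarith)
    obtain ⟨t, ht, htK⟩ := hmid ((1 + β) / 2) (by linarith) (by linarith)
    have hxb : x = a + β • (b - a) := by
      rw [← hxab, show α = 1 - β by linarith]; module
    have hs' : -(β / 2) • (b - a) = s • (y - x) := by
      have : s • (y - x) = a + (β / 2) • (b - a) - x := by rw [hs]; abel
      rw [this, hxb]; module
    have ht' : ((1 - β) / 2) • (b - a) = t • (y - x) := by
      have : t • (y - x) = a + ((1 + β) / 2) • (b - a) - x := by rw [ht]; abel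
      rw [this, hxb]; module
    have hba : b - a ≠ 0 := sub_ne_zero.2 hab.symm
    have hyx' : y - x ≠ 0 := sub_ne_zero.2 hyx
    have hrel : (1 - β) * s + β * t = 0 := by
      have : ((1 - β) * s + β * t) • (y - x) = 0 := by
        rw [add_smul, mul_smul, mul_smul, ← hs', ← ht']; module
      exact (smul_eq_zero.1 this).resolve_right hyx'
    have hs0 : s ≠ 0 := by
      rintro rfl
      rw [zero_smul] at hs'
      exact (smul_eq_zero.1 hs').elim (by intro h; linarith) hba
    have hβ1 : 0 < 1 - β := by linarith
    rcases lt_or_gt_of_ne hs0 with hneg | hpos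
    · refine ⟨-s, by linarith, ?_⟩
      rw [hs] at hsK
      convert hsK using 1
      module
    · refine ⟨-t, ?_, ?_⟩
      · by_contra hcon
        have : 0 ≤ t := by linarith
        have := mul_pos hβ1 hpos
        have := mul_nonneg hβ.le ‹0 ≤ t›
        linarith
      · rw [ht] at htK
        convert htK using 1
        module
  · have hle : affineSpan ℝ K ≤ AffineSubspace.mk' x (twoSidedDirections hK hx) := by
      refine affineSpan_le.2 fun z hz => ?_
      obtain ⟨ε, hε, hε'⟩ := h z hz
      refine AffineSubspace.mem_mk'.2 ⟨min ε 1, by positivity, ?_, ?_⟩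
      · convert hK hx hz (a := 1 - min ε 1) (b := min ε 1)
          (by linarith [min_le_right ε 1]) (by positivity) (by ring) using 1
        rw [vsub_eq_sub]
        module
      · have hr : min ε 1 / ε ≤ 1 := (div_le_one hε).2 (min_le_left _ _)
        convert hK hx hε' (a := 1 - min ε 1 / ε) (b := min ε 1 / ε)
          (by linarith) (by positivity) (by ring) using 1
        rw [vsub_eq_sub]
        match_scalars <;> field_simp; ring
    obtain ⟨ε, hε, h1, h2⟩ := AffineSubspace.mem_mk'.1 (hle hy)
    rw [vsub_eq_sub] at h1 h2
    have hyx' : y - x ≠ 0 := sub_ne_zero.2 hyx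
    refine ⟨x - ε • (y - x), x + ε • (y - x), fun heq => ?_,
      ⟨1 / 2, 1 / 2, by norm_num, by norm_num, by norm_num, by module⟩,
      Set.subset_inter ?_ (hK.openSegment_subset h2 h1)⟩
    · have : (2 * ε) • (y - x) = 0 := by
        rw [← sub_eq_zero] at heq
        rw [← neg_eq_zero, ← heq]; module
      exact (smul_eq_zero.1 this).elim (by intro h; linarith) hyx'
    · have hline : ∀ r : ℝ, x + r • (y - x) ∈ line[ℝ, x, y] := fun r =>
        mem_affineSpan_pair_iff_exists_lineMap_eq.2
          ⟨r, by rw [AffineMap.lineMap_apply_module']; abel⟩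
      refine (AffineSubspace.convex _).openSegment_subset ?_ (hline ε)
      have := hline (-ε)
      rwa [neg_smul, ← sub_eq_add_neg] at this

/-- A linear map commutes with the relative algebraic interior of a convex set, as soon as this
interior is not empty. -/
theorem rai_image {K : Set V} (hK : Convex ℝ K) (hne : (rai K).Nonempty) (L : V →ₗ[ℝ] V') :
    rai (L '' K) = L '' rai K := by
  have hLK := hK.linear_image L
  obtain ⟨x₀, hx₀⟩ := hne
  obtain ⟨hx₀K, hx₀'⟩ := (mem_rai_iff hK).1 hx₀
  ext z
  constructor
  · intro hz
    obtain ⟨-, hz'⟩ := (mem_rai_iff hLK).1 hz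
    obtain ⟨ε, hε, k, hk, hkz⟩ := hz' _ ⟨x₀, hx₀K, rfl⟩
    -- `z` lies strictly between `L x₀` and `L k`, and the points of the segment `[x₀, k]` other
    -- than `k` are in the relative algebraic interior.
    refine ⟨(1 / (1 + ε)) • k + (ε / (1 + ε)) • x₀, (mem_rai_iff hK).2 ⟨hK hk hx₀K (by positivity)
      (by positivity) (by field_simp), fun y hy => ?_⟩, ?_⟩
    · obtain ⟨δ, hδ, hu⟩ := hx₀' y hy
      refine ⟨ε * δ / (1 + ε + δ), by positivity, ?_⟩
      -- The step is chosen such that `x₀` cancels from the combination of `k`, `x₀` and `y`.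
      convert hK hk hu (a := (1 + δ) / (1 + ε + δ)) (b := ε / (1 + ε + δ)) (by positivity)
        (by positivity) (by field_simp; ring) using 1
      match_scalars <;> field_simp <;> ring
    · rw [map_add, map_smul, map_smul, hkz]
      match_scalars <;> field_simp
      ring
  · rintro ⟨x, hx, rfl⟩
    obtain ⟨hxK, hx'⟩ := (mem_rai_iff hK).1 hx
    refine (mem_rai_iff hLK).2 ⟨⟨x, hxK, rfl⟩, ?_⟩
    rintro _ ⟨y, hy, rfl⟩
    obtain ⟨ε, hε, h⟩ := hx' y hy
    exact ⟨ε, hε, _, h, by simp⟩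

end Rai

/-! ### Separation in finite dimension -/

section Separation

variable {E : Type*} [NormedAddCommGroup E] [NormedSpace ℝ E] [FiniteDimensional ℝ E]

/-- In a finite-dimensional space, a point outside a convex set can be weakly separated from it,
without any topological assumption on the set. -/
theorem exists_dual_nonpos_of_zero_notMem [Nontrivial E] {S : Set E} (hS : Convex ℝ S)
    (h0 : (0 : E) ∉ S) : ∃ f : E →L[ℝ] ℝ, f ≠ 0 ∧ ∀ s ∈ S, f s ≤ 0 := by
  by_cases hint : (interior S).Nonempty
  · obtain ⟨f, hf0, hf⟩ := geometric_hahn_banach_of_nonempty_interior_point hS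
      (fun h => h0 (interior_subset h)) hint
    exact ⟨f, hf0, by simpa using hf⟩
  · rw [hS.interior_nonempty_iff_affineSpan_eq_top] at hint
    rcases S.eq_empty_or_nonempty with rfl | ⟨s₀, hs₀⟩
    · obtain ⟨v, hv⟩ := exists_ne (0 : E)
      obtain ⟨f, -, hf⟩ := exists_dual_vector ℝ v (norm_ne_zero_iff.2 hv)
      refine ⟨f, ?_, by simp⟩
      rintro rfl
      exact hv (by simpa using hf.symm)
    · -- A proper affine subspace lies in a hyperplane `f = const`; one of `f`, `-f` works.
      have hdir : (affineSpan ℝ S).direction < ⊤ := by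
        refine lt_top_iff_ne_top.2 fun h => hint ?_
        exact (AffineSubspace.direction_eq_top_iff_of_nonempty
          ⟨s₀, subset_affineSpan ℝ S hs₀⟩).1 h
      obtain ⟨g, hg0, hg⟩ := Submodule.exists_le_ker_of_lt_top _ hdir
      have hconst : ∀ s ∈ S, g s = g s₀ := fun s hs => by
        have := hg (AffineSubspace.vsub_mem_direction (subset_affineSpan ℝ S hs)
          (subset_affineSpan ℝ S hs₀))
        rw [LinearMap.mem_ker, vsub_eq_sub, map_sub, sub_eq_zero] at this
        exact this
      have hne : LinearMap.toContinuousLinearMap g ≠ 0 := fun h => hg0 (by simpa using h)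
      rcases le_total (g s₀) 0 with h | h
      · exact ⟨LinearMap.toContinuousLinearMap g, hne, fun s hs => by simpa [hconst s hs] using h⟩
      · exact ⟨-LinearMap.toContinuousLinearMap g, neg_ne_zero.2 hne,
          fun s hs => by simpa [hconst s hs] using h⟩

/-- Weak separation of a convex set from the origin within a linear subspace `W`: the functional
does not vanish identically on `W`. -/
theorem exists_dual_nonpos_of_ne_bot {W : Submodule ℝ E} (hW : W ≠ ⊥) {S : Set E}
    (hS : Convex ℝ S) (h0 : (0 : E) ∉ S) :
    ∃ f : E →L[ℝ] ℝ, ¬ W ≤ LinearMap.ker (f : E →ₗ[ℝ] ℝ) ∧ ∀ s ∈ S, s ∈ W → f s ≤ 0 := by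
  have : Nontrivial W := Submodule.nontrivial_iff_ne_bot.2 hW
  obtain ⟨f, hf0, hf⟩ := exists_dual_nonpos_of_zero_notMem (E := W)
    (hS.linear_preimage W.subtype) (by simpa using h0)
  obtain ⟨g, hg, -⟩ := exists_extension_norm_eq W f
  refine ⟨g, fun hle => hf0 (ContinuousLinearMap.ext fun w => ?_), fun s hs hsW => ?_⟩
  · rw [← hg]; exact hle w.2
  · exact (hg ⟨s, hsW⟩).trans_le (hf ⟨s, hsW⟩ hs)

/-- A functional that does not vanish identically on `W` cuts out a subspace of smaller dimension;
this drives the inductions on the dimension of a subspace that carries a measure. -/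
theorem finrank_inf_ker_lt {W : Submodule ℝ E} {f : E →L[ℝ] ℝ}
    (hf : ¬ W ≤ LinearMap.ker (f : E →ₗ[ℝ] ℝ)) :
    Module.finrank ℝ (W ⊓ LinearMap.ker (f : E →ₗ[ℝ] ℝ) : Submodule ℝ E) < Module.finrank ℝ W :=
  Submodule.finrank_lt_finrank_of_lt (inf_lt_left.2 hf)

end Separation

/-! ### Bounded densities -/

section Densities

variable {Ω : Type*} [MeasurableSpace Ω]

/-- The real vector space of bounded measurable functions. These are honest functions, not classes
modulo a measure. -/
def boundedMeasurable (Ω : Type*) [MeasurableSpace Ω] : Submodule ℝ (Ω → ℝ) where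
  carrier := {h | Measurable h ∧ ∃ C : ℝ, ∀ x, |h x| ≤ C}
  zero_mem' := ⟨measurable_const, 0, by simp⟩
  add_mem' := by
    rintro f g ⟨hf, C, hC⟩ ⟨hg, D, hD⟩
    exact ⟨hf.add hg, C + D, fun x => (abs_add_le _ _).trans (add_le_add (hC x) (hD x))⟩
  smul_mem' := by
    rintro c f ⟨hf, C, hC⟩
    refine ⟨hf.const_smul c, |c| * C, fun x => ?_⟩
    rw [Pi.smul_apply, smul_eq_mul, abs_mul]
    exact mul_le_mul_of_nonneg_left (hC x) (abs_nonneg c)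

theorem measurable_boundedMeasurable (h : boundedMeasurable Ω) : Measurable (h : Ω → ℝ) := h.2.1

theorem exists_abs_le (h : boundedMeasurable Ω) : ∃ C : ℝ, 0 < C ∧ ∀ x, |(h : Ω → ℝ) x| ≤ C := by
  obtain ⟨C, hC⟩ := h.2.2
  exact ⟨max C 1, by positivity, fun x => (hC x).trans (le_max_left _ _)⟩

/-- Constants are bounded measurable functions. -/
def constBounded (Ω : Type*) [MeasurableSpace Ω] (r : ℝ) : boundedMeasurable Ω :=
  ⟨fun _ => r, measurable_const, |r|, fun _ => le_rfl⟩

@[simp] theorem constBounded_apply (r : ℝ) (x : Ω) : (constBounded Ω r : Ω → ℝ) x = r := rfl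

theorem integrable_smul_of_boundedMeasurable {E : Type*} [NormedAddCommGroup E] [NormedSpace ℝ E]
    {μ : Measure Ω} (h : boundedMeasurable Ω) {g : Ω → E} (hg : Integrable g μ) :
    Integrable (fun x => (h : Ω → ℝ) x • g x) μ := by
  obtain ⟨C, -, hC⟩ := exists_abs_le h
  exact hg.bdd_smul C (measurable_boundedMeasurable h).aestronglyMeasurable
    (Filter.Eventually.of_forall hC)

theorem integrable_boundedMeasurable {μ : Measure Ω} [IsFiniteMeasure μ]
    (h : boundedMeasurable Ω) : Integrable (h : Ω → ℝ) μ := by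
  simpa using integrable_smul_of_boundedMeasurable h (integrable_const (μ := μ) (1 : ℝ))

/-- The linear map `h ↦ ∫ h g dμ` on bounded measurable functions, for a vector-valued integrable
function `g`. -/
def integralAgainst {E : Type*} [NormedAddCommGroup E] [NormedSpace ℝ E]
    {μ : Measure Ω} {g : Ω → E} (hg : Integrable g μ) : boundedMeasurable Ω →ₗ[ℝ] E where
  toFun h := ∫ x, (h : Ω → ℝ) x • g x ∂μ
  map_add' h k := by
    simp only [Submodule.coe_add, Pi.add_apply, add_smul]
    exact integral_add (integrable_smul_of_boundedMeasurable h hg)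
      (integrable_smul_of_boundedMeasurable k hg)
  map_smul' c h := by
    simp only [Submodule.coe_smul, Pi.smul_apply, smul_eq_mul, mul_smul, RingHom.id_apply]
    exact integral_smul c _

/-- The linear map that sends a density to the signed measure with this density. -/
def densityMap (μ : Measure Ω) [IsFiniteMeasure μ] : boundedMeasurable Ω →ₗ[ℝ] SignedMeasure Ω where
  toFun h := μ.withDensityᵥ (h : Ω → ℝ)
  map_add' h k := withDensityᵥ_add (integrable_boundedMeasurable h) (integrable_boundedMeasurable k)
  map_smul' c _ := withDensityᵥ_smul _ c

/-- The convex set of bounded probability densities with respect to `μ`. -/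
def probDensities (μ : Measure Ω) : Set (boundedMeasurable Ω) :=
  {h | (∀ x, 0 ≤ (h : Ω → ℝ) x) ∧ ∫ x, (h : Ω → ℝ) x ∂μ = 1}

variable (μ : ProbabilityMeasure Ω)

theorem convex_probDensities (μ : Measure Ω) [IsFiniteMeasure μ] :
    Convex ℝ (probDensities μ) := by
  rintro h ⟨h0, h1⟩ k ⟨k0, k1⟩ a b ha hb hab
  refine ⟨fun x => ?_, ?_⟩
  · have := mul_nonneg ha (h0 x)
    have := mul_nonneg hb (k0 x)
    simpa using by linarith
  · simp only [Submodule.coe_add, Submodule.coe_smul, Pi.add_apply, Pi.smul_apply,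
      smul_eq_mul]
    rw [integral_add ((integrable_boundedMeasurable h).const_mul a)
      ((integrable_boundedMeasurable k).const_mul b), integral_const_mul, integral_const_mul, h1,
      k1]
    simpa using hab

theorem one_mem_probDensities : constBounded Ω 1 ∈ probDensities (μ : Measure Ω) :=
  ⟨fun x => by simp, by simp⟩

/-- The relative algebraic interior of the bounded probability densities consists of those that are
bounded away from zero. -/
theorem mem_rai_probDensities_iff (h : boundedMeasurable Ω) :
    h ∈ rai (probDensities (μ : Measure Ω)) ↔
      h ∈ probDensities (μ : Measure Ω) ∧ ∃ δ : ℝ, 0 < δ ∧ ∀ x, δ ≤ (h : Ω → ℝ) x := by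
  rw [mem_rai_iff (convex_probDensities _)]
  refine and_congr_right fun hh => ⟨fun H => ?_, ?_⟩
  · obtain ⟨ε, hε, h0, -⟩ := H _ (one_mem_probDensities μ)
    refine ⟨ε / (1 + ε), by positivity, fun x => ?_⟩
    have := h0 x
    simp at this
    rw [div_le_iff₀ (by positivity)]
    linarith
  · rintro ⟨δ, hδ, hδh⟩ y hy
    obtain ⟨C, hC, hyC⟩ := exists_abs_le y
    have h0 := hh.1
    refine ⟨δ / C, by positivity, fun x => ?_, ?_⟩
    · have h1 : δ / C * (y : Ω → ℝ) x ≤ δ := by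
        rw [div_mul_eq_mul_div, div_le_iff₀ hC]
        exact mul_le_mul_of_nonneg_left ((le_abs_self _).trans (hyC x)) hδ.le
      have h2 : 0 ≤ δ / C * (h : Ω → ℝ) x := mul_nonneg (by positivity) (h0 x)
      have h3 := hδh x
      simp
      linarith
    · have hhi := integrable_boundedMeasurable (μ := (μ : Measure Ω)) h
      have hyi := integrable_boundedMeasurable (μ := (μ : Measure Ω)) y
      have hsub : Integrable (fun x => (h : Ω → ℝ) x - (y : Ω → ℝ) x) (μ : Measure Ω) :=
        hhi.sub hyi
      simp only [Submodule.coe_add, Submodule.coe_smul, Submodule.coe_sub, Pi.add_apply,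
        Pi.smul_apply, Pi.sub_apply, smul_eq_mul]
      rw [integral_add hhi (hsub.const_mul _), integral_const_mul, integral_sub hhi hyi,
        hh.2, hy.2]
      simp

theorem one_mem_rai_probDensities : constBounded Ω 1 ∈ rai (probDensities (μ : Measure Ω)) :=
  (mem_rai_probDensities_iff μ _).2 ⟨one_mem_probDensities μ, 1, one_pos, fun _ => le_rfl⟩

/-- For a nonnegative density, `densityMap` yields the measure `withDensity`. -/
theorem toSigned_eq_densityMap_iff (ν : ProbabilityMeasure Ω) {h : boundedMeasurable Ω}
    (h0 : ∀ x, 0 ≤ (h : Ω → ℝ) x) :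
    toSigned ν = densityMap (μ : Measure Ω) h ↔
      (ν : Measure Ω) = (μ : Measure Ω).withDensity fun x => ENNReal.ofReal ((h : Ω → ℝ) x) := by
  have hi := integrable_boundedMeasurable (μ := (μ : Measure Ω)) h
  have hfin : ∫⁻ x, ENNReal.ofReal ((h : Ω → ℝ) x) ∂(μ : Measure Ω) ≠ ⊤ :=
    ((lintegral_ofReal_le_lintegral_enorm _).trans_lt hi.2).ne
  have : IsFiniteMeasure ((μ : Measure Ω).withDensity
      fun x => ENNReal.ofReal ((h : Ω → ℝ) x)) := isFiniteMeasure_withDensity hfin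
  have key := withDensityᵥ_toReal (μ := (μ : Measure Ω))
    (measurable_boundedMeasurable h).ennreal_ofReal.aemeasurable hfin
  simp only [ENNReal.toReal_ofReal (h0 _)] at key
  change _ = (μ : Measure Ω).withDensityᵥ (h : Ω → ℝ) ↔ _
  rw [key, toSigned, Measure.toSignedMeasure_eq_toSignedMeasure_iff]

theorem exists_toSigned_eq_densityMap {h : boundedMeasurable Ω}
    (hh : h ∈ probDensities (μ : Measure Ω)) :
    ∃ ν : ProbabilityMeasure Ω, toSigned ν = densityMap (μ : Measure Ω) h := by
  have hp : IsProbabilityMeasure ((μ : Measure Ω).withDensity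
      fun x => ENNReal.ofReal ((h : Ω → ℝ) x)) := by
    constructor
    rw [withDensity_apply _ MeasurableSet.univ, Measure.restrict_univ,
      ← ofReal_integral_eq_lintegral_ofReal (integrable_boundedMeasurable h)
        (Filter.Eventually.of_forall hh.1), hh.2, ENNReal.ofReal_one]
  exact ⟨⟨_, hp⟩, (toSigned_eq_densityMap_iff μ _ hh.1).2 rfl⟩

theorem toSigned_eq_densityMap_one : toSigned μ = densityMap (μ : Measure Ω) (constBounded Ω 1) :=
  (toSigned_eq_densityMap_iff μ μ fun _ => by simp).2 (by simp)

/-- A probability measure with an almost surely bounded density has an everywhere bounded one, with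
the same bounds. -/
theorem exists_density_of_rnDeriv_bounds {ν : ProbabilityMeasure Ω}
    (hac : (ν : Measure Ω) ≪ (μ : Measure Ω)) {a b : ℝ} (ha : 0 ≤ a) (hab : a ≤ b)
    (hbound : ∀ᵐ x ∂(μ : Measure Ω), ENNReal.ofReal a ≤ (ν : Measure Ω).rnDeriv μ x ∧
      (ν : Measure Ω).rnDeriv μ x ≤ ENNReal.ofReal b) :
    ∃ h ∈ probDensities (μ : Measure Ω),
      (∀ x, a ≤ (h : Ω → ℝ) x) ∧ toSigned ν = densityMap (μ : Measure Ω) h := by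
  have hb : 0 ≤ b := ha.trans hab
  let h : boundedMeasurable Ω := ⟨fun x => max a (min b ((ν : Measure Ω).rnDeriv μ x).toReal),
    measurable_const.max (measurable_const.min (Measure.measurable_rnDeriv _ _).ennreal_toReal),
    b, fun x => by
      rw [abs_of_nonneg (ha.trans (le_max_left _ _))]
      exact max_le hab (min_le_left _ _)⟩
  have hle : ∀ x, a ≤ (h : Ω → ℝ) x := fun x => le_max_left _ _
  have h0 : ∀ x, 0 ≤ (h : Ω → ℝ) x := fun x => ha.trans (hle x)
  have hae : (fun x => ENNReal.ofReal ((h : Ω → ℝ) x)) =ᵐ[(μ : Measure Ω)]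
      (ν : Measure Ω).rnDeriv μ := by
    filter_upwards [hbound] with x hx
    have hfin : (ν : Measure Ω).rnDeriv μ x ≠ ⊤ := (hx.2.trans_lt ENNReal.ofReal_lt_top).ne
    have h1 : ((ν : Measure Ω).rnDeriv μ x).toReal ≤ b := ENNReal.toReal_le_of_le_ofReal hb hx.2
    have h2 : a ≤ ((ν : Measure Ω).rnDeriv μ x).toReal :=
      (ENNReal.ofReal_le_iff_le_toReal hfin).1 hx.1
    change ENNReal.ofReal (max a (min b _)) = _
    rw [min_eq_right h1, max_eq_right h2, ENNReal.ofReal_toReal hfin]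
  have hν : (ν : Measure Ω) =
      (μ : Measure Ω).withDensity fun x => ENNReal.ofReal ((h : Ω → ℝ) x) := by
    rw [withDensity_congr_ae hae, Measure.withDensity_rnDeriv_eq _ _ hac]
  refine ⟨h, ⟨h0, ?_⟩, hle, (toSigned_eq_densityMap_iff μ ν h0).2 hν⟩
  have h1 : ∫⁻ x, ENNReal.ofReal ((h : Ω → ℝ) x) ∂(μ : Measure Ω) = 1 := by
    rw [← setLIntegral_univ, ← withDensity_apply _ MeasurableSet.univ, ← hν, measure_univ]
  rw [integral_eq_lintegral_of_nonneg_ae (Filter.Eventually.of_forall h0)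
    (measurable_boundedMeasurable h).aestronglyMeasurable, h1, ENNReal.toReal_one]

theorem exists_density_of_le_smul {ν : ProbabilityMeasure Ω} {c : ℝ} (hc : 0 ≤ c)
    (hle : (ν : Measure Ω) ≤ ENNReal.ofReal c • (μ : Measure Ω)) :
    ∃ h ∈ probDensities (μ : Measure Ω), toSigned ν = densityMap (μ : Measure Ω) h := by
  have hac : (ν : Measure Ω) ≪ (μ : Measure Ω) := Measure.absolutelyContinuous_of_le_smul hle
  have hb : (ν : Measure Ω).rnDeriv μ ≤ᵐ[(μ : Measure Ω)] fun _ => ENNReal.ofReal c := by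
    refine ae_le_of_forall_setLIntegral_le_of_sigmaFinite (Measure.measurable_rnDeriv _ _)
      fun s hs _ => ?_
    rw [Measure.setLIntegral_rnDeriv hac, setLIntegral_const]
    exact hle s
  obtain ⟨h, hh, -, hν⟩ := exists_density_of_rnDeriv_bounds μ hac le_rfl hc
    (hb.mono fun x hx => ⟨by simp, hx⟩)
  exact ⟨h, hh, hν⟩

/-- The face generated by `μ` consists of the probability measures with bounded density. -/
theorem probFace_eq : probFace μ = densityMap (μ : Measure Ω) '' probDensities (μ : Measure Ω) := by
  have hsub : densityMap (μ : Measure Ω) '' probDensities (μ : Measure Ω) ⊆ probSet Ω := by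
    rintro _ ⟨h, hh, rfl⟩
    obtain ⟨ν, hν⟩ := exists_toSigned_eq_densityMap μ hh
    exact ⟨ν, hν⟩
  apply Set.Subset.antisymm
  · refine Set.sInter_subset_of_mem ⟨⟨⟨hsub, ?_⟩, (convex_probDensities _).linear_image _⟩,
      constBounded Ω 1, one_mem_probDensities μ, (toSigned_eq_densityMap_one μ).symm⟩
    · rintro _ ⟨ν₁, rfl⟩ _ ⟨ν₂, rfl⟩ _ ⟨h, hh, rfl⟩ ⟨a, b, ha, hb, hab, heq⟩
      obtain ⟨ν, hν⟩ := exists_toSigned_eq_densityMap μ hh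
      obtain ⟨C, hC, hhC⟩ := exists_abs_le h
      -- `a ν₁ ≤ ν ≤ C μ`, so `ν₁` has a density bounded by `C / a`.
      obtain ⟨k, hk, hνk⟩ := exists_density_of_le_smul μ (ν := ν₁) (c := C / a) (by positivity) <| by
        refine Measure.le_iff.2 fun s hs => ?_
        have h1 : a * (ν₁ : Measure Ω).real s + b * (ν₂ : Measure Ω).real s =
            (ν : Measure Ω).real s := by
          have := congrArg (fun v : SignedMeasure Ω => v s) (heq.trans hν.symm)
          simpa [toSigned, Measure.toSignedMeasure_apply_measurable hs] using this
        have h2 : (ν : Measure Ω).real s ≤ C * (μ : Measure Ω).real s := by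
          have h3 : (ν : Measure Ω) s ≤ ENNReal.ofReal C * (μ : Measure Ω) s := by
            rw [(toSigned_eq_densityMap_iff μ ν hh.1).1 hν, withDensity_apply _ hs,
              ← setLIntegral_const]
            exact lintegral_mono fun x =>
              ENNReal.ofReal_le_ofReal ((le_abs_self _).trans (hhC x))
          have := ENNReal.toReal_mono
            (ENNReal.mul_ne_top ENNReal.ofReal_ne_top (measure_ne_top _ _)) h3
          rwa [ENNReal.toReal_mul, ENNReal.toReal_ofReal hC.le] at this
        have h4 : (ν₁ : Measure Ω).real s ≤ C / a * (μ : Measure Ω).real s := by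
          rw [div_mul_eq_mul_div, le_div_iff₀ ha]
          have := mul_nonneg hb.le (measureReal_nonneg (μ := (ν₂ : Measure Ω)) (s := s))
          linarith
        rw [Measure.smul_apply, smul_eq_mul, ← ofReal_measureReal, ← ofReal_measureReal,
          ← ENNReal.ofReal_mul (by positivity)]
        exact ENNReal.ofReal_le_ofReal h4
      exact ⟨k, hk, hνk.symm⟩
  · rintro _ ⟨h, hh, rfl⟩ F ⟨⟨hF, -⟩, hμF⟩
    obtain ⟨C₀, hC₀, hhC₀⟩ := exists_abs_le h
    obtain ⟨C, hC1, hC⟩ : ∃ C : ℝ, 1 < C ∧ ∀ x, (h : Ω → ℝ) x ≤ C :=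
      ⟨C₀ + 1, by linarith, fun x => ((le_abs_self _).trans (hhC₀ x)).trans (by linarith)⟩
    have hC0 : 0 < C := by linarith
    have hC1' : 0 < C - 1 := by linarith
    -- `1 = (1 / C) h + (1 - 1 / C) k`, where `k` is again a probability density.
    let k : boundedMeasurable Ω := (C / (C - 1)) • (constBounded Ω 1 - (1 / C) • h)
    have hk : k ∈ probDensities (μ : Measure Ω) := by
      refine ⟨fun x => ?_, ?_⟩
      · have : 0 ≤ C / (C - 1) * (1 - 1 / C * (h : Ω → ℝ) x) := by
          refine mul_nonneg (by positivity) (sub_nonneg.2 ?_)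
          rw [one_div_mul_eq_div]
          exact (div_le_one hC0).2 (hC x)
        simpa [k] using this
      · have hhi := integrable_boundedMeasurable (μ := (μ : Measure Ω)) h
        have : ∫ x, (k : Ω → ℝ) x ∂(μ : Measure Ω) =
            ∫ x, C / (C - 1) * (1 - 1 / C * (h : Ω → ℝ) x) ∂(μ : Measure Ω) := by simp [k]
        rw [this, integral_const_mul, integral_sub (integrable_const _) (hhi.const_mul _),
          integral_const_mul, hh.2]
        simp
        field_simp
    refine hF.left_mem_of_mem_openSegment (hsub ⟨h, hh, rfl⟩) (hsub ⟨k, hk, rfl⟩) hμF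
      ⟨1 / C, (C - 1) / C, by positivity, by positivity, by field_simp; ring, ?_⟩
    rw [toSigned_eq_densityMap_one, ← map_smul, ← map_smul, ← map_add]
    congr 1
    simp only [k]
    match_scalars <;> field_simp
    ring

/-- A probability measure is given by a density in the relative algebraic interior if and only if
it is equivalent to `μ` with density bounded above and away from zero. -/
theorem exists_mem_rai_probDensities_iff (ν : ProbabilityMeasure Ω) :
    (∃ h ∈ rai (probDensities (μ : Measure Ω)), toSigned ν = densityMap (μ : Measure Ω) h) ↔
      ((ν : Measure Ω) ≪ (μ : Measure Ω) ∧ (μ : Measure Ω) ≪ (ν : Measure Ω)) ∧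
        ∃ c : ℝ, 1 < c ∧ ∀ᵐ x ∂(μ : Measure Ω),
          ENNReal.ofReal (1 / c) ≤ (ν : Measure Ω).rnDeriv (μ : Measure Ω) x ∧
            (ν : Measure Ω).rnDeriv (μ : Measure Ω) x ≤ ENNReal.ofReal c := by
  constructor
  · rintro ⟨h, hh, hν⟩
    obtain ⟨⟨h0, h1⟩, δ, hδ, hδh⟩ := (mem_rai_probDensities_iff μ h).1 hh
    obtain ⟨C, hC, hhC⟩ := exists_abs_le h
    rw [toSigned_eq_densityMap_iff μ ν h0] at hν
    have hm := (measurable_boundedMeasurable h).ennreal_ofReal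
    refine ⟨⟨?_, ?_⟩, max (max C (1 / δ)) 2, by simp, ?_⟩
    · rw [hν]; exact withDensity_absolutelyContinuous _ _
    · rw [hν]
      refine withDensity_absolutelyContinuous' hm.aemeasurable
        (Filter.Eventually.of_forall fun x => ?_)
      exact (ENNReal.ofReal_pos.2 (hδ.trans_le (hδh x))).ne'
    · rw [hν]
      filter_upwards [Measure.rnDeriv_withDensity (μ : Measure Ω) hm] with x hx
      rw [hx]
      refine ⟨ENNReal.ofReal_le_ofReal (le_trans ?_ (hδh x)), ENNReal.ofReal_le_ofReal
        (((le_abs_self _).trans (hhC x)).trans ((le_max_left _ _).trans (le_max_left _ _)))⟩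
      rw [one_div_le (by positivity) hδ]
      exact (le_max_right _ _).trans (le_max_left _ _)
  · rintro ⟨⟨hac, -⟩, c, hc, hb⟩
    have hc0 : 0 < c := by linarith
    obtain ⟨h, hh, hle, hν⟩ := exists_density_of_rnDeriv_bounds μ hac (by positivity)
      (((div_le_one hc0).2 hc.le).trans hc.le) hb
    exact ⟨h, (mem_rai_probDensities_iff μ h).2 ⟨hh, 1 / c, by positivity, hle⟩, hν⟩

end Densities

/-! ### Barycenters and convex sets of full measure -/

section Barycenters

theorem integral_mem_submodule {Ω E : Type*} [MeasurableSpace Ω] [NormedAddCommGroup E]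
    [NormedSpace ℝ E] [FiniteDimensional ℝ E] {μ : Measure Ω} {g : Ω → E} (hg : Integrable g μ)
    {W : Submodule ℝ E} (hW : ∀ᵐ y ∂μ, g y ∈ W) : ∫ y, g y ∂μ ∈ W := by
  by_contra hnot
  obtain ⟨f, hf, hWf⟩ := Submodule.exists_le_ker_of_notMem hnot
  refine hf ?_
  have h1 := (LinearMap.toContinuousLinearMap f).integral_comp_comm hg
  rw [LinearMap.coe_toContinuousLinearMap'] at h1
  rw [← h1, integral_eq_zero_of_ae]
  filter_upwards [hW] with y hy
  exact hWf hy

variable {E : Type*} [NormedAddCommGroup E] [NormedSpace ℝ E] [FiniteDimensional ℝ E]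
  [MeasurableSpace E]

/-- The barycenter of a probability measure carried by a convex set lies in this set. In finite
dimension the set need not be closed: if the barycenter `x` could be weakly separated from the set,
then the measure would be carried by the separating hyperplane through `x`, and the dimension
drops. -/
theorem integral_mem_of_convex {ν : Measure E} [IsProbabilityMeasure ν]
    (hν : Integrable (fun y : E => y) ν) {C : Set E} (hC : Convex ℝ C) (hνC : ∀ᵐ y ∂ν, y ∈ C) :
    ∫ y, y ∂ν ∈ C := by
  set x := ∫ y, y ∂ν with hx
  by_contra hxC
  suffices H : ∀ n : ℕ, ∀ W : Submodule ℝ E, Module.finrank ℝ W = n →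
      ¬ ∀ᵐ y ∂ν, y - x ∈ W from H _ ⊤ rfl (by simp)
  intro n
  induction n using Nat.strong_induction_on with
  | _ n ih =>
    intro W hWn hW
    have hW0 : W ≠ ⊥ := by
      rintro rfl
      obtain ⟨y, hy, hyC⟩ := (hW.and hνC).exists
      rw [Submodule.mem_bot, sub_eq_zero] at hy
      exact hxC (hy ▸ hyC)
    obtain ⟨f, hfW, hf⟩ := exists_dual_nonpos_of_ne_bot hW0 (hC.translate_preimage_right x)
      (by simpa using hxC)
    have hle : ∀ᵐ y ∂ν, 0 ≤ -f (y - x) := by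
      filter_upwards [hW, hνC] with y hy hyC
      have := hf (y - x) (by simpa using hyC) hy
      linarith
    have hi : Integrable (fun y => y - x) ν := hν.sub (integrable_const x)
    have h0 : ∫ y, -f (y - x) ∂ν = 0 := by
      rw [integral_neg, f.integral_comp_comm hi, integral_sub hν (integrable_const x)]
      simp [← hx]
    have hker := (integral_eq_zero_iff_of_nonneg_ae hle (f.integrable_comp hi).neg).1 h0
    refine ih _ (hWn ▸ finrank_inf_ker_lt hfW) _ rfl ?_
    filter_upwards [hW, hker] with y hy hy0
    exact ⟨hy, neg_eq_zero.1 hy0⟩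

variable [BorelSpace E]

/-- If `x` is not the barycenter of any bounded density, then some convex Borel set of full measure
misses `x`. The hypothesis says that a nonnegative bounded `h` with `∫ h(y) (y - x) dμ(y) = 0` has
`∫ h dμ = 0`. A functional `f` that weakly separates these barycenters from `x` satisfies
`f (y - x) ≤ 0` almost surely; the convex set is the open half-space `f (y - x) < 0` together with a
convex subset of the hyperplane `f (y - x) = 0` obtained by induction on the dimension. -/
theorem exists_convex_measurable_notMem (x : E) (n : ℕ) : ∀ (W : Submodule ℝ E),
    Module.finrank ℝ W = n → ∀ (μ : Measure E) [IsFiniteMeasure μ],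
    Integrable (fun y : E => y) μ → (∀ᵐ y ∂μ, y - x ∈ W) →
    (∀ h : boundedMeasurable E, (∀ y, 0 ≤ (h : E → ℝ) y) →
      ∫ y, (h : E → ℝ) y • (y - x) ∂μ = 0 → ∫ y, (h : E → ℝ) y ∂μ = 0) →
    ∃ C : Set E, Convex ℝ C ∧ MeasurableSet C ∧ (∀ᵐ y ∂μ, y ∈ C) ∧ x ∉ C := by
  induction n using Nat.strong_induction_on with
  | _ n ih =>
    intro W hWn μ _ hμ hW H
    have hi : Integrable (fun y => y - x) μ := hμ.sub (integrable_const x)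
    rcases eq_or_ne W ⊥ with rfl | hW0
    · have hzero : ∫ y, ((constBounded E 1 : boundedMeasurable E) : E → ℝ) y • (y - x) ∂μ = 0 := by
        refine integral_eq_zero_of_ae ?_
        filter_upwards [hW] with y hy
        simpa using hy
      have := H (constBounded E 1) (fun y => by simp) hzero
      have hμ0 : μ = 0 := by simpa [measureReal_eq_zero_iff] using this
      exact ⟨∅, convex_empty, MeasurableSet.empty, by simp [hμ0], by simp⟩
    let S : Set E := integralAgainst hi ''
      {h | (∀ y, 0 ≤ (h : E → ℝ) y) ∧ 0 < ∫ y, (h : E → ℝ) y ∂μ}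
    have hS : Convex ℝ S := by
      refine Convex.linear_image ?_ _
      rintro h ⟨h0, h1⟩ k ⟨k0, k1⟩ a b ha hb hab
      refine ⟨fun y => ?_, ?_⟩
      · have := mul_nonneg ha (h0 y)
        have := mul_nonneg hb (k0 y)
        simpa using by linarith
      · simp only [Submodule.coe_add, Submodule.coe_smul, Pi.add_apply, Pi.smul_apply, smul_eq_mul]
        rw [integral_add ((integrable_boundedMeasurable h).const_mul a)
          ((integrable_boundedMeasurable k).const_mul b), integral_const_mul, integral_const_mul]
        exact (convex_Ioi (0 : ℝ)) h1 k1 ha hb hab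
    have h0S : (0 : E) ∉ S := by
      rintro ⟨h, ⟨h0, h1⟩, heq⟩
      exact h1.ne' (H h h0 heq)
    have hSW : S ⊆ W := by
      rintro _ ⟨h, -, rfl⟩
      refine integral_mem_submodule (integrable_smul_of_boundedMeasurable h hi) ?_
      filter_upwards [hW] with y hy
      exact W.smul_mem _ hy
    obtain ⟨f, hfW, hf⟩ := exists_dual_nonpos_of_ne_bot hW0 hS h0S
    have hfm : Measurable fun y => f (y - x) :=
      f.continuous.measurable.comp (measurable_id.sub_const x)
    have hfi : Integrable (fun y => f (y - x)) μ := f.integrable_comp hi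
    -- Testing with the indicator of `{f (y - x) > 0}` shows that this set is null.
    have hle : ∀ᵐ y ∂μ, f (y - x) ≤ 0 := by
      set A : Set E := {y | 0 < f (y - x)} with hA
      have hAm : MeasurableSet A := measurableSet_lt measurable_const hfm
      suffices hA0 : μ A = 0 by
        exact measure_mono_null (fun y hy =>
          not_le.1 (show ¬ f (y - x) ≤ 0 from hy)) hA0
      by_contra hA0
      let h : boundedMeasurable E := ⟨A.indicator fun _ => 1, measurable_const.indicator hAm, 1,
        fun y => by by_cases hy : y ∈ A <;> simp [hy]⟩
      have hmem : integralAgainst hi h ∈ S := by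
        refine ⟨h, ⟨fun y => Set.indicator_nonneg (fun _ _ => zero_le_one) y, ?_⟩, rfl⟩
        change 0 < ∫ y, A.indicator (fun _ => (1 : ℝ)) y ∂μ
        rw [integral_indicator hAm]
        simpa [Measure.real] using ENNReal.toReal_pos hA0 (measure_ne_top _ _)
      have hnonpos := hf _ hmem (hSW hmem)
      have hcalc : f (integralAgainst hi h) = ∫ y in A, f (y - x) ∂μ := by
        change f (∫ y, (h : E → ℝ) y • (y - x) ∂μ) = _
        rw [← f.integral_comp_comm (integrable_smul_of_boundedMeasurable h hi),
          ← integral_indicator hAm]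
        congr 1
        ext y
        by_cases hy : y ∈ A <;> simp [h, hy]
      have hpos : 0 < ∫ y in A, f (y - x) ∂μ := by
        rw [setIntegral_pos_iff_support_of_nonneg_ae _ hfi.integrableOn]
        · refine lt_of_lt_of_le (pos_iff_ne_zero.2 hA0) (measure_mono fun y hy => ⟨?_, hy⟩)
          exact (show 0 < f (y - x) from hy).ne'
        · filter_upwards [ae_restrict_mem hAm] with y hy
          exact (show 0 < f (y - x) from hy).le
      rw [hcalc] at hnonpos
      linarith
    set B : Set E := {y | f (y - x) = 0} with hB
    have hBm : MeasurableSet B := measurableSet_eq_fun hfm measurable_const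
    obtain ⟨C, hCc, hCm, hC, hxC⟩ := ih _ (hWn ▸ finrank_inf_ker_lt hfW) _ rfl (μ.restrict B)
      hμ.restrict (by
        filter_upwards [ae_restrict_of_ae hW, ae_restrict_mem hBm] with y hy hyB
        exact ⟨hy, hyB⟩) (by
        intro h h0 hint
        let k : boundedMeasurable E := ⟨B.indicator (h : E → ℝ),
          (measurable_boundedMeasurable h).indicator hBm, by
            obtain ⟨C, hC, hhC⟩ := exists_abs_le h
            refine ⟨C, fun y => ?_⟩
            by_cases hy : y ∈ B <;> simp [hy, hhC y, hC.le]⟩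
        have hk := H k (fun y => Set.indicator_nonneg (fun y _ => h0 y) y) (by
          rw [← hint, ← integral_indicator hBm]
          congr 1
          ext y
          by_cases hy : y ∈ B <;> simp [k, hy])
        rwa [← integral_indicator hBm])
    refine ⟨{y | f (y - x) < 0} ∪ (C ∩ B), ?_, (measurableSet_lt hfm measurable_const).union
      (hCm.inter hBm), ?_, ?_⟩
    · intro p hp q hq a b ha hb hab
      have hlin : f (a • p + b • q - x) = a * f (p - x) + b * f (q - x) := by
        have : a • p + b • q - x = a • (p - x) + b • (q - x) := by
          have hb' : b = 1 - a := by linarith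
          subst hb'
          module
        rw [this, map_add, map_smul, map_smul, smul_eq_mul, smul_eq_mul]
      have hp0 : f (p - x) ≤ 0 := hp.elim (fun h => le_of_lt h) fun h => le_of_eq h.2
      have hq0 : f (q - x) ≤ 0 := hq.elim (fun h => le_of_lt h) fun h => le_of_eq h.2
      -- A degenerate combination is one of the two points.
      rcases ha.eq_or_lt with rfl | ha
      · obtain rfl : b = 1 := by linarith
        simpa using hq
      rcases hb.eq_or_lt with rfl | hb
      · obtain rfl : a = 1 := by linarith
        simpa using hp
      have hap := mul_nonpos_of_nonneg_of_nonpos ha.le hp0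
      have hbq := mul_nonpos_of_nonneg_of_nonpos hb.le hq0
      rcases hp with hp | hp
      · left
        have := mul_neg_of_pos_of_neg ha hp
        change f _ < 0
        linarith
      rcases hq with hq | hq
      · left
        have := mul_neg_of_pos_of_neg hb hq
        change f _ < 0
        linarith
      · right
        refine ⟨hCc hp.1 hq.1 ha.le hb.le hab, ?_⟩
        change f _ = 0
        rw [hlin, show f (p - x) = 0 from hp.2, show f (q - x) = 0 from hq.2]
        simp
    · filter_upwards [hle, (ae_restrict_iff' hBm).1 hC] with y hy hyC
      rcases hy.lt_or_eq with h | h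
      · exact Or.inl h
      · exact Or.inr ⟨hyC h, h⟩
    · rintro (h | h)
      · simp at h
      · exact hxC h.1

end Barycenters

/-! ### The convex core -/

section Euclidean

variable {d : ℕ} (μ : ProbabilityMeasure (EuclideanSpace ℝ (Fin d)))

theorem HasMean.integrable_id {μ : ProbabilityMeasure (EuclideanSpace ℝ (Fin d))}
    (hμ : HasMean μ) :
    Integrable (fun x : EuclideanSpace ℝ (Fin d) => x) (μ : Measure _) := by
  have h1 : Integrable (fun x : EuclideanSpace ℝ (Fin d) => fun i => x i) (μ : Measure _) :=
    Integrable.of_eval hμ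
  exact (EuclideanSpace.equiv (Fin d) ℝ).symm.toContinuousLinearMap.integrable_comp h1

variable {μ}

theorem mean_eq_integralAgainst (hμ : HasMean μ) {ν : ProbabilityMeasure _}
    {h : boundedMeasurable (EuclideanSpace ℝ (Fin d))}
    (hh : h ∈ probDensities (μ : Measure (EuclideanSpace ℝ (Fin d))))
    (hν : toSigned ν = densityMap (μ : Measure _) h) :
    HasMean ν ∧ mean ν = integralAgainst hμ.integrable_id h := by
  rw [toSigned_eq_densityMap_iff μ ν hh.1] at hν
  have hm := (measurable_boundedMeasurable h).ennreal_ofReal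
  constructor
  · intro i
    rw [hν, integrable_withDensity_iff_integrable_smul' hm (by simp)]
    simpa only [ENNReal.toReal_ofReal (hh.1 _)] using integrable_smul_of_boundedMeasurable h (hμ i)
  · rw [mean, hν, integral_withDensity_eq_integral_toReal_smul hm (by simp)]
    simp only [ENNReal.toReal_ofReal (hh.1 _)]
    rfl

/-- The convex core consists of the barycenters of bounded probability densities. -/
theorem convexCore_eq (hμ : HasMean μ) : convexCore μ =
    integralAgainst hμ.integrable_id ''
      probDensities (μ : Measure (EuclideanSpace ℝ (Fin d))) := by
  apply Set.Subset.antisymm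
  · intro x hx
    by_contra hnot
    have hi := hμ.integrable_id
    obtain ⟨C, hCc, hCm, hC, hxC⟩ := exists_convex_measurable_notMem x _ ⊤ rfl
      (μ : Measure (EuclideanSpace ℝ (Fin d))) hi (by simp) (by
        intro h h0 hint
        by_contra hne
        -- Otherwise `h / ∫ h dμ` is a probability density with barycenter `x`.
        refine hnot ⟨(∫ y, (h : _ → ℝ) y ∂(μ : Measure (EuclideanSpace ℝ (Fin d))))⁻¹ • h,
          ⟨fun y => ?_, ?_⟩, ?_⟩
        · exact mul_nonneg (inv_nonneg.2 (integral_nonneg h0)) (h0 y)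
        · simp only [Submodule.coe_smul, Pi.smul_apply, smul_eq_mul]
          rw [integral_const_mul, inv_mul_cancel₀ hne]
        · have h1 : integralAgainst hi h =
              (∫ y, (h : _ → ℝ) y ∂(μ : Measure (EuclideanSpace ℝ (Fin d)))) • x := by
            simp only [smul_sub] at hint
            rw [integral_sub (integrable_smul_of_boundedMeasurable h hi)
              ((integrable_boundedMeasurable h).smul_const x), integral_smul_const,
              sub_eq_zero] at hint
            exact hint
          rw [map_smul, h1, smul_smul, inv_mul_cancel₀ hne, one_smul])
    exact hxC (hx C ⟨hCc, hCm, measure_congr (Filter.eventuallyEq_univ.2 hC)⟩)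
  · rintro _ ⟨h, hh, rfl⟩ C ⟨hCc, hCm, hC⟩
    obtain ⟨ν, hν⟩ := exists_toSigned_eq_densityMap μ hh
    obtain ⟨hνm, hνh⟩ := mean_eq_integralAgainst hμ hh hν
    rw [← hνh]
    refine integral_mem_of_convex hνm.integrable_id hCc ?_
    rw [(toSigned_eq_densityMap_iff μ ν hh.1).1 hν]
    refine (withDensity_absolutelyContinuous _ _).ae_le ?_
    rw [measure_univ] at hC
    exact (prob_compl_eq_zero_iff hCm).2 hC

/-- Means of measures given by a set of densities are the barycenters of these densities. -/
theorem mean_image_eq (hμ : HasMean μ) {S : Set (boundedMeasurable (EuclideanSpace ℝ (Fin d)))}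
    (hS : S ⊆ probDensities (μ : Measure (EuclideanSpace ℝ (Fin d)))) :
    mean '' {ν | ∃ h ∈ S, toSigned ν = densityMap (μ : Measure _) h} =
      integralAgainst hμ.integrable_id '' S := by
  ext x
  constructor
  · rintro ⟨ν, ⟨h, hh, hν⟩, rfl⟩
    exact ⟨h, hh, (mean_eq_integralAgainst hμ (hS hh) hν).2.symm⟩
  · rintro ⟨h, hh, rfl⟩
    obtain ⟨ν, hν⟩ := exists_toSigned_eq_densityMap μ (hS hh)
    exact ⟨ν, ⟨h, hh, hν⟩, (mean_eq_integralAgainst hμ (hS hh) hν).2⟩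

theorem meanImage_densityMap_image (hμ : HasMean μ)
    {S : Set (boundedMeasurable (EuclideanSpace ℝ (Fin d)))}
    (hS : S ⊆ probDensities (μ : Measure (EuclideanSpace ℝ (Fin d)))) :
    meanImage (densityMap (μ : Measure _) '' S) = integralAgainst hμ.integrable_id '' S := by
  rw [← mean_image_eq hμ hS, meanImage]
  simp only [Set.mem_image, eq_comm]

end Euclidean
end ConvexCore

theorem mainTheorem12 {d : ℕ} (μ : ProbabilityMeasure (EuclideanSpace ℝ (Fin d)))
    (hμ : ConvexCore.HasMean μ) :
    (∀ ν : ProbabilityMeasure (EuclideanSpace ℝ (Fin d)),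
      ConvexCore.toSigned ν ∈ ConvexCore.probFace μ → ConvexCore.HasMean ν) ∧
    ConvexCore.convexCore μ = ConvexCore.meanImage (ConvexCore.probFace μ) ∧
    ConvexCore.rai (ConvexCore.convexCore μ) =
      ConvexCore.meanImage (ConvexCore.rai (ConvexCore.probFace μ)) ∧
    ConvexCore.rai (ConvexCore.convexCore μ) =
      ConvexCore.mean '' {ν : ProbabilityMeasure (EuclideanSpace ℝ (Fin d)) |
        ((ν : Measure (EuclideanSpace ℝ (Fin d))) ≪ (μ : Measure (EuclideanSpace ℝ (Fin d))) ∧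
          (μ : Measure (EuclideanSpace ℝ (Fin d))) ≪ (ν : Measure (EuclideanSpace ℝ (Fin d)))) ∧
        ∃ c : ℝ, 1 < c ∧ ∀ᵐ x ∂(μ : Measure (EuclideanSpace ℝ (Fin d))),
          ENNReal.ofReal (1 / c) ≤
              (ν : Measure (EuclideanSpace ℝ (Fin d))).rnDeriv
                (μ : Measure (EuclideanSpace ℝ (Fin d))) x ∧
            (ν : Measure (EuclideanSpace ℝ (Fin d))).rnDeriv
                (μ : Measure (EuclideanSpace ℝ (Fin d))) x ≤ ENNReal.ofReal c} := by
  have hconv := ConvexCore.convex_probDensities (μ : Measure (EuclideanSpace ℝ (Fin d)))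
  have hne : (ConvexCore.rai
      (ConvexCore.probDensities (μ : Measure (EuclideanSpace ℝ (Fin d))))).Nonempty :=
    ⟨_, ConvexCore.one_mem_rai_probDensities μ⟩
  have hsub : ConvexCore.rai
      (ConvexCore.probDensities (μ : Measure (EuclideanSpace ℝ (Fin d)))) ⊆
      ConvexCore.probDensities (μ : Measure (EuclideanSpace ℝ (Fin d))) := fun _ h => h.1
  rw [ConvexCore.probFace_eq, ConvexCore.convexCore_eq hμ,
    ConvexCore.rai_image hconv hne, ConvexCore.rai_image hconv hne,
    ConvexCore.meanImage_densityMap_image hμ subset_rfl,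
    ConvexCore.meanImage_densityMap_image hμ hsub, ← ConvexCore.mean_image_eq hμ hsub]
  refine ⟨?_, rfl, rfl, ?_⟩
  · rintro ν ⟨h, hh, hν⟩
    exact (ConvexCore.mean_eq_integralAgainst hμ hh hν.symm).1
  · simp only [ConvexCore.exists_mem_rai_probDensities_iff]

end
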